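/- Let $(X,\mu)$ be a standard probability space and let $\mathcal G$ be a Borel graph on $X$ (a simple undirected graph whose edge relation is a Borel subset of $X^2$) with the following two properties. - Bounded degree: there is $d\in\mathbb N$ such that, after discarding a $\mathcal G$-invariant $\mu$-null set of vertices (that is, for almost every $x$, at every vertex of the connected component of $x$), all degrees are at most $d$. - Probability-measure-preserving (pmp): whenever $A\subseteq X$ is Borel and $\theta:A\to X$ is an injective Borel map such that $\theta(x)$ lies in the connected component of $x$ for every $x\in A$, then $\mu(\theta(A))=\mu(A)$. Then the adjacency operator $T_{\mathcal G}$ on the complex Hilbert space $L^2(X,\mu)$, given by $(T_{\mathcal G}f)(x)=\sum_{y\sim x}f(y)$ for almost every $x$, is a well-defined bounded self-adjoint operator. The numbers $$M(T_{\mathcal G})=\sup_{f\ne0}\frac{\langle T_{\mathcal G}f,f\rangle}{\langle f,f\rangle},\qquad m(T_{\mathcal G})=\inf_{f\neq 0}\frac{\langle T_{\mathcal G}f,f\rangle}{\langle f,f\rangle}$$ are the maximum and the minimum of its spectrum, $m(T_{\mathcal G})<0$ unless $T_{\mathcal G}=0$, and $$\chi^{\mathrm{ap}}_\mu(\mathcal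 G)\ \ge\ \left\lceil 1-\frac{M(T_{\mathcal G})}{m(T_{\mathcal G})}\right\rceil ,$$ where, in the degenerate case $T_{\mathcal G}=0$ (in which $M(T_{\mathcal G})=m(T_{\mathcal G})=0$), the quotient is read as $0$. Here $\chi^{\mathrm{ap}}_\mu(\mathcal G)$, the approximate $\mu$-measurable chromatic number, is the least $k\in\mathbb N$ such that for every $\varepsilon>0$ there is a Borel set $A\subseteq X$ with $\mu(A)>1-\varepsilon$ for which the induced graph $\mathcal G\restriction A$ has a proper $k$-colouring with $\mu$-measurable colour classes ($\infty$ if there is no such $k$). -/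

import Mathlib

open MeasureTheory
open scoped ENNReal

namespace BorelGraph

variable {X : Type*} [MeasurableSpace X]

/-- A Borel graph: a simple undirected graph whose edge relation is a Borel subset of `X × X`. -/
def IsBorel (G : SimpleGraph X) : Prop :=
  MeasurableSet {p : X × X | G.Adj p.1 p.2}

/-- Bounded degree, up to discarding an invariant null set: there is `d` such that, for almost
every `x`, all vertices of the connected component of `x` have at most `d` neighbours.
In particular, it is enough that every vertex has at most `d` neighbours. -/
def HasBoundedDegree (G : SimpleGraph X) (μ : Measure X) : Prop :=
  ∃ d : ℕ, ∀ᵐ x ∂μ, ∀ y : X, G.Reachable x y → (G.neighborSet y).encard ≤ d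

/-- The connectedness relation of `G` is measure preserving: every partial Borel bijection
`θ : A → θ '' A` with `A` Borel and graph contained in the connectedness relation of `G`
satisfies `μ (θ '' A) = μ A`. -/
def IsMeasurePreserving (G : SimpleGraph X) (μ : Measure X) : Prop :=
  ∀ (A : Set X) (θ : X → X), MeasurableSet A → Measurable θ → Set.InjOn θ A →
    (∀ x ∈ A, G.Reachable x (θ x)) → μ (θ '' A) = μ A

/-- For every `ε > 0` there is a Borel set `A` with `μ A > 1 - ε` such that the induced graph on
`A` has a proper colouring with `k` colours whose colour classes are `μ`-measurable. -/
def ApproxColorable (G : SimpleGraph X) (μ : Measure X) (k : ℕ) : Prop :=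
  ∀ ε : ℝ, 0 < ε → ∃ A : Set X, MeasurableSet A ∧ 1 - ε < μ.real A ∧
    ∃ c : (G.induce A).Coloring (Fin k),
      ∀ i : Fin k, NullMeasurableSet (Subtype.val '' {a : A | c a = i}) μ

/-- The approximate `μ`-measurable chromatic number: the least `k` such that `G` is approximately
`k`-colourable, and `⊤` if there is no such `k`. -/
noncomputable def approxChromaticNumber (G : SimpleGraph X) (μ : Measure X) : ℕ∞ :=
  ⨅ (k : ℕ) (_ : ApproxColorable G μ k), (k : ℕ∞)

/-- `T` is the adjacency operator of `G` on the complex Hilbert space `L²(X, μ)`: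
`(T f)(x) = ∑_{y ∼ x} f(y)` for almost every `x`, whichever representative `g` of the class
`f` is used to evaluate the sum. There is at most one such `T`. -/
def IsAdjacencyOperator (G : SimpleGraph X) (μ : Measure X)
    (T : Lp ℂ 2 μ →L[ℂ] Lp ℂ 2 μ) : Prop :=
  ∀ (f : Lp ℂ 2 μ) (g : X → ℂ), g =ᵐ[μ] f →
    T f =ᵐ[μ] fun x => ∑ᶠ y ∈ G.neighborSet x, g y

end BorelGraph

section Spectral

variable {H : Type*} [NormedAddCommGroup H] [InnerProductSpace ℂ H]

/-- `M(T) = sup_{f ≠ 0} ⟨T f, f⟩ / ⟨f, f⟩`, for a bounded self-adjoint operator `T`. -/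
noncomputable def upperSpectralBound (T : H →L[ℂ] H) : ℝ :=
  ⨆ f : {f : H // f ≠ 0}, T.rayleighQuotient f

/-- `m(T) = inf_{f ≠ 0} ⟨T f, f⟩ / ⟨f, f⟩`, for a bounded self-adjoint operator `T`. -/
noncomputable def lowerSpectralBound (T : H →L[ℂ] H) : ℝ :=
  ⨅ f : {f : H // f ≠ 0}, T.rayleighQuotient f

/-- The real numbers in the spectrum of `T` (all of the spectrum, if `T` is self-adjoint). -/
def realSpectralValues (T : H →L[ℂ] H) : Set ℝ :=
  {r : ℝ | (r : ℂ) ∈ spectrum ℂ T}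

end Spectral

open scoped InnerProductSpace

universe u

/-! ### Borel sets with sections of bounded finite size. -/

namespace BorelGraph

/-! The bound is Hoffman's argument. Let `m` be the lower spectral bound and cut `f = ∑ f_i` along
`k` disjoint independent sets. Each `⟨T f_i, f_i⟩` vanishes, and positivity of `T - m` on the
differences `f_i - f_j` gives `⟨T f, f⟩ ≤ -(k - 1) m ‖f‖²` (`reApplyInnerSelf_sum_le`). An
approximate colouring yields this for `f` supported on sets of measure close to `1`, and such `f`
are dense (`reApplyInnerSelf_le_of_approx`). So `M ≤ -(k - 1) m`, and one divides by `m < 0`.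

For the sign of `m`, countably many Borel independent sets cover almost all of `X`
(`exists_independent_cover`), hence finitely many cover all but `ε`. If `T ≥ 0`, the same inequality
with `0` in place of `m` forces `⟨T f, f⟩ ≤ 0`, so `T = 0`.

To build `T`, the edges leaving a conull Borel set are split into finitely many Borel graphs of
partial injections (`exists_partition_injections`). Each preserves measure and acts on `L²` by
composition, with adjoint given by the inverse graph; `T` is the sum. The splitting peels off the
least point of every section, after a Borel embedding into `ℝ`. -/

theorem encard_section_lt {X Y : Type*} {e : Y → ℝ}
    {E : Set (X × Y)} {d : ℕ} (hE : ∀ x, {y | (x, y) ∈ E}.encard ≤ (d + 1 : ℕ)) (p : X × Y) :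
    {y | p ∈ E ∧ (p.1, y) ∈ E ∧ e y < e p.2}.encard ≤ d := by
  by_cases hp : p ∈ E
  · have hsub : insert p.2 {y | p ∈ E ∧ (p.1, y) ∈ E ∧ e y < e p.2} ⊆ {y | (p.1, y) ∈ E} := by
      rintro y (rfl | hy)
      · exact hp
      · exact hy.2.1
    have h := (Set.encard_le_encard hsub).trans (hE p.1)
    rw [Set.encard_insert_of_notMem (by simp), Nat.cast_add, Nat.cast_one] at h
    exact (ENat.add_le_add_iff_right (by simp)).1 h
  · simp [hp]

theorem encard_section_nonminimal {X Y : Type*} {e : Y → ℝ}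
    {E : Set (X × Y)} {d : ℕ} (hE : ∀ x, {y | (x, y) ∈ E}.encard ≤ (d + 1 : ℕ)) (x : X) :
    {y | (x, y) ∈ E ∧ ∃ y', (x, y') ∈ E ∧ e y' < e y}.encard ≤ d := by
  have hfin : {y | (x, y) ∈ E}.Finite :=
    Set.finite_of_encard_le_coe (hE x)
  rcases Set.eq_empty_or_nonempty {y | (x, y) ∈ E} with h0 | hne
  · have : {y | (x, y) ∈ E ∧ ∃ y', (x, y') ∈ E ∧ e y' < e y} ⊆ {y | (x, y) ∈ E} :=
      fun y hy => hy.1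
    rw [h0] at this
    simp [Set.subset_eq_empty this rfl]
  · obtain ⟨a, ha, hmin⟩ := Set.exists_min_image _ e hfin hne
    have hsub : insert a {y | (x, y) ∈ E ∧ ∃ y', (x, y') ∈ E ∧ e y' < e y} ⊆
        {y | (x, y) ∈ E} := by
      rintro y (rfl | hy)
      · exact ha
      · exact hy.1
    have h := (Set.encard_le_encard hsub).trans (hE x)
    rw [Set.encard_insert_of_notMem, Nat.cast_add, Nat.cast_one] at h
    · exact (ENat.add_le_add_iff_right (by simp)).1 h
    · rintro ⟨-, y', hy', hlt⟩
      exact absurd (hmin y' hy') (not_le.2 hlt)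

theorem injOn_fst_minimal {X Y : Type*} {e : Y → ℝ} (he : Function.Injective e)
    (E : Set (X × Y)) :
    Set.InjOn Prod.fst (E \ {p | p ∈ E ∧ ∃ y', (p.1, y') ∈ E ∧ e y' < e p.2}) := by
  rintro ⟨x, y⟩ ⟨hy, hy'⟩ ⟨x', z⟩ ⟨hz, hz'⟩ (rfl : x = x')
  have h1 : ¬ e z < e y := fun h => hy' ⟨hy, z, hz, h⟩
  have h2 : ¬ e y < e z := fun h => hz' ⟨hz, y, hy, h⟩
  rw [he (le_antisymm (not_lt.1 h1) (not_lt.1 h2))]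

theorem image_fst_diff_nonminimal {X Y : Type*} {e : Y → ℝ}
    {E : Set (X × Y)} {d : ℕ} (hE : ∀ x, {y | (x, y) ∈ E}.encard ≤ d) :
    Prod.fst '' (E \ {p | p ∈ E ∧ ∃ y', (p.1, y') ∈ E ∧ e y' < e p.2}) = Prod.fst '' E := by
  refine Set.Subset.antisymm (Set.image_mono Set.sdiff_subset) ?_
  rintro _ ⟨⟨x, y⟩, hxy, rfl⟩
  obtain ⟨a, ha, hmin⟩ := Set.exists_min_image {y | (x, y) ∈ E} e
    (Set.finite_of_encard_le_coe (hE x)) ⟨y, hxy⟩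
  refine ⟨(x, a), ⟨ha, ?_⟩, rfl⟩
  rintro ⟨-, y', hy', hlt⟩
  exact absurd (hmin y' hy') (not_le.2 hlt)

theorem eq_empty_of_encard_le_zero {X Y : Type*} {E : Set (X × Y)}
    (hE : ∀ x, {y | (x, y) ∈ E}.encard ≤ (0 : ℕ)) : E = ∅ := by
  ext ⟨x, y⟩
  have h : {y | (x, y) ∈ E} = ∅ := by simpa using hE x
  exact iff_of_false (fun hy => (h ▸ (show y ∈ {y | (x, y) ∈ E} from hy) : y ∈ (∅ : Set Y))) id

/-- Over a pair, the fibre of this projection consists of strictly smaller points, so it misses the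
pair's own point and is smaller than the section. This drives the induction on `d`. -/
theorem nonminimal_eq_image {X Y : Type*} (e : Y → ℝ) (E : Set (X × Y)) :
    {p | p ∈ E ∧ ∃ y', (p.1, y') ∈ E ∧ e y' < e p.2} =
      Prod.fst '' {q : (X × Y) × Y | q.1 ∈ E ∧ (q.1.1, q.2) ∈ E ∧ e q.2 < e q.1.2} := by
  ext p
  constructor
  · rintro ⟨hp, y', hy', hlt⟩
    exact ⟨(p, y'), ⟨hp, hy', hlt⟩, rfl⟩
  · rintro ⟨⟨p, y'⟩, ⟨hp, hy', hlt⟩, rfl⟩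
    exact ⟨hp, y', hy', hlt⟩

theorem measurableSet_nonminimal_witness {X Y : Type*} [MeasurableSpace X] [MeasurableSpace Y]
    {e : Y → ℝ} (he : Measurable e) {E : Set (X × Y)} (hE : MeasurableSet E) :
    MeasurableSet {q : (X × Y) × Y | q.1 ∈ E ∧ (q.1.1, q.2) ∈ E ∧ e q.2 < e q.1.2} := by
  have h1 : MeasurableSet {q : (X × Y) × Y | q.1 ∈ E} := measurable_fst hE
  have h2 : MeasurableSet {q : (X × Y) × Y | (q.1.1, q.2) ∈ E} :=
    (show Measurable fun q : (X × Y) × Y => (q.1.1, q.2) by fun_prop) hE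
  have h3 : MeasurableSet {q : (X × Y) × Y | e q.2 < e q.1.2} :=
    measurableSet_lt (by fun_prop) (by fun_prop)
  exact h1.inter (h2.inter h3)

/-- A Borel set whose vertical sections have at most `d` points has a Borel projection. -/
theorem measurableSet_image_fst_of_encard_le {Y : Type u} [MeasurableSpace Y]
    [StandardBorelSpace Y] (d : ℕ) : ∀ {X : Type u} [MeasurableSpace X] [StandardBorelSpace X]
    {E : Set (X × Y)}, MeasurableSet E → (∀ x, {y | (x, y) ∈ E}.encard ≤ d) →
    MeasurableSet (Prod.fst '' E) := by
  induction d with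
  | zero =>
    intro X _ _ E _ hd
    simp [eq_empty_of_encard_le_zero hd]
  | succ d ih =>
    intro X _ _ E hE hd
    obtain ⟨e, he⟩ := exists_measurableEmbedding_real Y
    -- Keeping only the least point of each section preserves the projection and makes it injective,
    -- so Lusin–Souslin applies.
    rw [← image_fst_diff_nonminimal (e := e) hd]
    refine (hE.diff ?_).image_of_measurable_injOn measurable_fst
      (injOn_fst_minimal he.injective E)
    rw [nonminimal_eq_image]
    -- The induction hypothesis is used over the base `X × Y`, so the base must vary in the
    -- statement.
    exact ih (measurableSet_nonminimal_witness he.measurable hE) (encard_section_lt hd)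

theorem measurableSet_nonminimal {X Y : Type u} [MeasurableSpace X] [StandardBorelSpace X]
    [MeasurableSpace Y] [StandardBorelSpace Y] {e : Y → ℝ} (he : Measurable e) {d : ℕ}
    {E : Set (X × Y)} (hE : MeasurableSet E) (hd : ∀ x, {y | (x, y) ∈ E}.encard ≤ (d + 1 : ℕ)) :
    MeasurableSet {p | p ∈ E ∧ ∃ y', (p.1, y') ∈ E ∧ e y' < e p.2} := by
  rw [nonminimal_eq_image]
  exact measurableSet_image_fst_of_encard_le d (measurableSet_nonminimal_witness he hE)
    (encard_section_lt hd)

/-- The Lusin-Novikov theorem for bounded sections: a Borel set whose vertical sections have at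
most `d` points is a disjoint union of `d` Borel graphs of partial functions. -/
theorem exists_partition_graphs {X Y : Type u} [MeasurableSpace X] [StandardBorelSpace X]
    [MeasurableSpace Y] [StandardBorelSpace Y] (d : ℕ) : ∀ {E : Set (X × Y)}, MeasurableSet E →
    (∀ x, {y | (x, y) ∈ E}.encard ≤ d) →
    ∃ D : Fin d → Set (X × Y), (∀ i, MeasurableSet (D i)) ∧ (∀ i, Set.InjOn Prod.fst (D i)) ∧
      Pairwise (Function.onFun Disjoint D) ∧ ⋃ i, D i = E := by
  induction d with
  | zero =>
    intro E _ hd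
    exact ⟨fun _ => ∅, fun i => i.elim0, fun i => i.elim0, fun i => i.elim0,
      by simp [eq_empty_of_encard_le_zero hd]⟩
  | succ d ih =>
    intro E hE hd
    obtain ⟨e, he⟩ := exists_measurableEmbedding_real Y
    have hE' := measurableSet_nonminimal he.measurable hE hd
    obtain ⟨D, hD, hinj, hdisj, hU⟩ := ih hE' (encard_section_nonminimal hd)
    have hsub : ∀ i, D i ⊆ {p | p ∈ E ∧ ∃ y', (p.1, y') ∈ E ∧ e y' < e p.2} :=
      fun i => hU ▸ Set.subset_iUnion D i
    refine ⟨Fin.cons (E \ {p | p ∈ E ∧ ∃ y', (p.1, y') ∈ E ∧ e y' < e p.2}) D, ?_, ?_, ?_, ?_⟩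
    · exact Fin.cases (hE.diff hE') hD
    · exact Fin.cases (injOn_fst_minimal he.injective E) hinj
    · intro i j
      refine Fin.cases ?_ (fun i => ?_) i <;> refine Fin.cases ?_ (fun j => ?_) j
      · exact fun h => absurd rfl h
      · exact fun _ => Set.disjoint_sdiff_left.mono_right (hsub j)
      · exact fun _ => (Set.disjoint_sdiff_left.mono_right (hsub i)).symm
      · exact fun h => hdisj (fun h' => h (congrArg _ h'))
    · have h : (⋃ i, (Fin.cons (E \ {p | p ∈ E ∧ ∃ y', (p.1, y') ∈ E ∧ e y' < e p.2}) D :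
          Fin (d + 1) → Set (X × Y)) i) =
          (E \ {p | p ∈ E ∧ ∃ y', (p.1, y') ∈ E ∧ e y' < e p.2}) ∪ ⋃ i, D i := by
        ext p
        simp only [Set.mem_iUnion, Fin.exists_fin_succ, Fin.cons_zero, Fin.cons_succ,
          Set.mem_union]
      rw [h, hU]
      exact Set.sdiff_union_of_subset fun p hp => hp.1

/-- A Borel set whose sections in both directions have at most `d` points is a finite disjoint
union of Borel graphs of partial injections. -/
theorem exists_partition_injections {X Y : Type u} [MeasurableSpace X] [StandardBorelSpace X]
    [MeasurableSpace Y] [StandardBorelSpace Y] {d : ℕ} {E : Set (X × Y)} (hE : MeasurableSet E)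
    (h₁ : ∀ x, {y | (x, y) ∈ E}.encard ≤ d) (h₂ : ∀ y, {x | (x, y) ∈ E}.encard ≤ d) :
    ∃ D : Fin d × Fin d → Set (X × Y), (∀ i, MeasurableSet (D i)) ∧
      (∀ i, Set.InjOn Prod.fst (D i)) ∧ (∀ i, Set.InjOn Prod.snd (D i)) ∧
      Pairwise (Function.onFun Disjoint D) ∧ ⋃ i, D i = E := by
  obtain ⟨P, hP, hPinj, hPdisj, hPU⟩ := exists_partition_graphs d hE h₁
  obtain ⟨Q, hQ, hQinj, hQdisj, hQU⟩ := exists_partition_graphs d (measurable_swap hE) h₂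
  -- Common refinement of the two partitions: `P` makes the first projection injective, `Q` the
  -- second.
  refine ⟨fun i => P i.1 ∩ Prod.swap ⁻¹' Q i.2, fun i => (hP _).inter (measurable_swap (hQ _)),
    fun i => (hPinj _).mono Set.inter_subset_left, ?_, ?_, ?_⟩
  · rintro i p ⟨-, hp⟩ q ⟨-, hq⟩ h
    exact Prod.swap_injective (hQinj i.2 hp hq h)
  · rintro ⟨i, i'⟩ ⟨j, j'⟩ hij
    refine Set.disjoint_left.2 ?_
    rintro p ⟨hp, hp'⟩ ⟨hq, hq'⟩
    refine hij (Prod.ext ?_ ?_)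
    · by_contra h
      exact Set.disjoint_left.1 (hPdisj h) hp hq
    · by_contra h
      exact Set.disjoint_left.1 (hQdisj h) hp' hq'
  · ext p
    simp only [Set.mem_iUnion, Prod.exists, Set.mem_inter_iff, Set.mem_preimage]
    constructor
    · rintro ⟨i, -, hp, -⟩
      exact hPU ▸ Set.mem_iUnion_of_mem i hp
    · intro hp
      obtain ⟨i, hi⟩ := Set.mem_iUnion.1 (hPU.symm ▸ hp : p ∈ ⋃ i, P i)
      obtain ⟨j, hj⟩ := Set.mem_iUnion.1
        (hQU.symm ▸ (show p.swap ∈ Prod.swap ⁻¹' E by simpa using hp) : p.swap ∈ ⋃ i, Q i)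
      exact ⟨i, j, hi, hj⟩

end BorelGraph

/-! ### Rayleigh quotients and the spectrum. -/

section Spectral

variable {H : Type*} [NormedAddCommGroup H] [InnerProductSpace ℂ H]

theorem rayleighQuotient_bddAbove (T : H →L[ℂ] H) :
    BddAbove (Set.range fun f : {f : H // f ≠ 0} => T.rayleighQuotient f) :=
  ⟨‖T‖, by rintro _ ⟨f, rfl⟩; exact (le_abs_self _).trans (T.rayleighQuotient_le_norm _)⟩

theorem rayleighQuotient_bddBelow (T : H →L[ℂ] H) :
    BddBelow (Set.range fun f : {f : H // f ≠ 0} => T.rayleighQuotient f) :=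
  ⟨-‖T‖, by rintro _ ⟨f, rfl⟩; exact neg_le_of_abs_le (T.rayleighQuotient_le_norm _)⟩

theorem upperSpectralBound_le_iff [Nontrivial H] (T : H →L[ℂ] H) (r : ℝ) :
    upperSpectralBound T ≤ r ↔ ∀ f, T.reApplyInnerSelf f ≤ r * ‖f‖ ^ 2 := by
  obtain ⟨f₀, hf₀⟩ := exists_ne (0 : H)
  have : Nonempty {f : H // f ≠ 0} := ⟨⟨f₀, hf₀⟩⟩
  rw [upperSpectralBound, ciSup_le_iff (rayleighQuotient_bddAbove T)]
  constructor
  · intro h f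
    by_cases hf : f = 0
    · simp [hf, ContinuousLinearMap.reApplyInnerSelf_apply]
    · exact (div_le_iff₀ (by positivity)).1 (h ⟨f, hf⟩)
  · rintro h ⟨f, hf⟩
    exact (div_le_iff₀ (by positivity)).2 (h f)

theorem le_lowerSpectralBound_iff [Nontrivial H] (T : H →L[ℂ] H) (r : ℝ) :
    r ≤ lowerSpectralBound T ↔ ∀ f, r * ‖f‖ ^ 2 ≤ T.reApplyInnerSelf f := by
  obtain ⟨f₀, hf₀⟩ := exists_ne (0 : H)
  have : Nonempty {f : H // f ≠ 0} := ⟨⟨f₀, hf₀⟩⟩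
  rw [lowerSpectralBound, le_ciInf_iff (rayleighQuotient_bddBelow T)]
  constructor
  · intro h f
    by_cases hf : f = 0
    · simp [hf, ContinuousLinearMap.reApplyInnerSelf_apply]
    · exact (le_div_iff₀ (by positivity)).1 (h ⟨f, hf⟩)
  · rintro h ⟨f, hf⟩
    exact (le_div_iff₀ (by positivity)).2 (h f)

theorem reApplyInnerSelf_algebraMap_sub (T : H →L[ℂ] H) (r : ℝ) (f : H) :
    (algebraMap ℝ (H →L[ℂ] H) r - T).reApplyInnerSelf f =
      r * ‖f‖ ^ 2 - T.reApplyInnerSelf f := by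
  have h : (algebraMap ℝ (H →L[ℂ] H) r) f = (r : ℂ) • f := by
    rw [Algebra.algebraMap_eq_smul_one]; simp
  have hff : (⟪f, f⟫_ℂ).re = ‖f‖ ^ 2 := inner_self_eq_norm_sq (𝕜 := ℂ) f
  simp only [ContinuousLinearMap.reApplyInnerSelf_apply, sub_apply, h,
    inner_sub_left, inner_smul_left, map_sub, RCLike.re_to_complex, Complex.conj_ofReal,
    Complex.re_ofReal_mul, hff]

theorem realSpectralValues_eq (T : H →L[ℂ] H) : realSpectralValues T = spectrum ℝ T := by
  ext r
  exact spectrum.algebraMap_mem_iff ℂ (R := ℝ)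

variable [CompleteSpace H]

theorem le_algebraMap_iff_reApplyInnerSelf {T : H →L[ℂ] H} (hT : IsSelfAdjoint T) (r : ℝ) :
    T ≤ algebraMap ℝ _ r ↔ ∀ f, T.reApplyInnerSelf f ≤ r * ‖f‖ ^ 2 := by
  rw [ContinuousLinearMap.le_def, ContinuousLinearMap.isPositive_def',
    and_iff_right ((IsSelfAdjoint.algebraMap _ (IsSelfAdjoint.all r)).sub hT)]
  simp [reApplyInnerSelf_algebraMap_sub]

theorem algebraMap_le_iff_reApplyInnerSelf {T : H →L[ℂ] H} (hT : IsSelfAdjoint T) (r : ℝ) :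
    algebraMap ℝ _ r ≤ T ↔ ∀ f, r * ‖f‖ ^ 2 ≤ T.reApplyInnerSelf f := by
  have h := le_algebraMap_iff_reApplyInnerSelf hT.neg (-r)
  rw [map_neg, neg_le_neg_iff] at h
  rw [h]
  simp [ContinuousLinearMap.reApplyInnerSelf_apply]

/-- The supremum of the Rayleigh quotient of a self-adjoint operator is the maximum of its
spectrum. -/
theorem isGreatest_upperSpectralBound [Nontrivial H] {T : H →L[ℂ] H} (hT : IsSelfAdjoint T) :
    IsGreatest (realSpectralValues T) (upperSpectralBound T) := by
  rw [realSpectralValues_eq]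
  obtain ⟨M, hM⟩ := (ContinuousFunctionalCalculus.isCompact_spectrum (R := ℝ) T).exists_isGreatest
    (ContinuousFunctionalCalculus.spectrum_nonempty T hT)
  suffices h : upperSpectralBound T = M from h ▸ hM
  -- Both numbers have the same upper bounds `r`: each condition says `T ≤ r` in the operator order.
  refine eq_of_forall_ge_iff fun r => ?_
  rw [upperSpectralBound_le_iff, ← le_algebraMap_iff_reApplyInnerSelf hT,
    le_algebraMap_iff_spectrum_le]
  exact ⟨fun h => h M hM.1, fun h x hx => (hM.2 hx).trans h⟩

/-- The infimum of the Rayleigh quotient of a self-adjoint operator is the minimum of its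
spectrum. -/
theorem isLeast_lowerSpectralBound [Nontrivial H] {T : H →L[ℂ] H} (hT : IsSelfAdjoint T) :
    IsLeast (realSpectralValues T) (lowerSpectralBound T) := by
  rw [realSpectralValues_eq]
  obtain ⟨m, hm⟩ := (ContinuousFunctionalCalculus.isCompact_spectrum (R := ℝ) T).exists_isLeast
    (ContinuousFunctionalCalculus.spectrum_nonempty T hT)
  suffices h : lowerSpectralBound T = m from h ▸ hm
  refine eq_of_forall_le_iff fun r => ?_
  rw [le_lowerSpectralBound_iff, ← algebraMap_le_iff_reApplyInnerSelf hT,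
    algebraMap_le_iff_le_spectrum]
  exact ⟨fun h => h m hm.1, fun h x hx => h.trans (hm.2 hx)⟩

theorem eq_zero_of_reApplyInnerSelf_eq_zero {T : H →L[ℂ] H} (hT : IsSelfAdjoint T)
    (h : ∀ f, T.reApplyInnerSelf f = 0) : T = 0 := by
  have h0 : algebraMap ℝ (H →L[ℂ] H) 0 = 0 := map_zero _
  refine le_antisymm ?_ ?_
  · rw [← h0, le_algebraMap_iff_reApplyInnerSelf hT]
    simp [h]
  · rw [← h0, algebraMap_le_iff_reApplyInnerSelf hT]
    simp [h]

end Spectral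

/-! ### Hoffman's inequality in Hilbert space. -/

section Hoffman

variable {H : Type*} [NormedAddCommGroup H] [InnerProductSpace ℂ H]

/-- Hoffman's inequality: if `m ≤ T` and the diagonal blocks of `T` with respect to `k` orthogonal
vectors vanish, then `T` is at most `-(k - 1) m` on their sum. -/
theorem reApplyInnerSelf_sum_le {ι : Type*} [Fintype ι] {T : H →L[ℂ] H} {m : ℝ}
    (hm : ∀ f, m * ‖f‖ ^ 2 ≤ T.reApplyInnerSelf f) {f : ι → H}
    (horth : Pairwise fun i j => ⟪f i, f j⟫_ℂ = 0) (hdiag : ∀ i, T.reApplyInnerSelf (f i) = 0) :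
    T.reApplyInnerSelf (∑ i, f i) ≤ -((Fintype.card ι : ℝ) - 1) * m * ‖∑ i, f i‖ ^ 2 := by
  -- The real form of `T - m`, positive semidefinite by `hm`.
  set b : H → H → ℝ := fun g h => (⟪T g, h⟫_ℂ).re - m * (⟪g, h⟫_ℂ).re with hb
  have hbself : ∀ g, b g g = T.reApplyInnerSelf g - m * ‖g‖ ^ 2 := fun g => by
    have : (⟪g, g⟫_ℂ).re = ‖g‖ ^ 2 := inner_self_eq_norm_sq (𝕜 := ℂ) g
    simp only [hb, ContinuousLinearMap.reApplyInnerSelf_apply, this]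
    rfl
  have hnorm : ‖∑ i, f i‖ ^ 2 = ∑ i, ‖f i‖ ^ 2 := by
    rw [← inner_self_eq_norm_sq (𝕜 := ℂ), sum_inner]
    simp only [inner_sum, map_sum]
    refine Finset.sum_congr rfl fun i _ => ?_
    rw [Finset.sum_eq_single i (fun j _ hj => by simp [horth hj.symm]) (by simp),
      inner_self_eq_norm_sq]
  have hsum : b (∑ i, f i) (∑ i, f i) = ∑ i, ∑ j, b (f i) (f j) := by
    simp only [hb, map_sum, sum_inner, inner_sum, Complex.re_sum, Finset.mul_sum,
      Finset.sum_sub_distrib]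
    congr 1 <;> exact Finset.sum_comm
  have hpos : 0 ≤ ∑ i, ∑ j, b (f i - f j) (f i - f j) := by
    refine Finset.sum_nonneg fun i _ => Finset.sum_nonneg fun j _ => ?_
    rw [hbself]
    exact sub_nonneg.2 (hm _)
  have hexp : ∀ i j, b (f i - f j) (f i - f j) =
      b (f i) (f i) + b (f j) (f j) - b (f i) (f j) - b (f j) (f i) := fun i j => by
    simp only [hb, map_sub, inner_sub_left, inner_sub_right, Complex.sub_re]
    ring
  simp only [hexp, Finset.sum_sub_distrib, Finset.sum_add_distrib, Finset.sum_const,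
    Finset.card_univ, nsmul_eq_mul] at hpos
  rw [Finset.sum_comm (f := fun i j => b (f j) (f i)), ← hsum, ← Finset.mul_sum, hbself] at hpos
  simp only [hbself, hdiag, zero_sub, Finset.sum_neg_distrib, ← Finset.mul_sum, ← hnorm] at hpos
  -- With `f = ∑ f_i` and `k` the number of summands, `hpos` now reads `0 ≤ -2 k m ‖f‖² - 2 (⟨T f,
  -- f⟩ - m ‖f‖²)`.
  nlinarith

end Hoffman

/-! ### Composition operators of partial measure-preserving maps. -/

section Transfer

variable {X : Type*} [MeasurableSpace X] {μ : Measure X}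

theorem memLp_indicator_comp {A B : Set X} (hA : MeasurableSet A) {θ : X → X}
    (hθ : MeasurePreserving θ (μ.restrict A) (μ.restrict B)) (f : Lp ℂ 2 μ) :
    MemLp (A.indicator (f ∘ θ)) 2 μ :=
  (memLp_indicator_iff_restrict hA).2 (((Lp.memLp f).restrict B).comp_measurePreserving hθ)

theorem indicator_comp_ae_eq {A B : Set X} (hA : MeasurableSet A) {θ : X → X}
    (hθ : MeasurePreserving θ (μ.restrict A) (μ.restrict B)) {f g : X → ℂ} (h : f =ᵐ[μ] g) :
    A.indicator (f ∘ θ) =ᵐ[μ] A.indicator (g ∘ θ) := by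
  have h' := hθ.quasiMeasurePreserving.ae_eq_comp (ae_restrict_of_ae h)
  filter_upwards [(ae_restrict_iff' hA).1 h'] with x hx
  by_cases hxA : x ∈ A
  · rw [Set.indicator_of_mem hxA, Set.indicator_of_mem hxA, hx hxA]
  · rw [Set.indicator_of_notMem hxA, Set.indicator_of_notMem hxA]

/-- The partial isometry of `L²` induced by a measure preserving map from `A` to `B`. -/
theorem exists_indicator_comp {A B : Set X} (hA : MeasurableSet A) {θ : X → X}
    (hθ : MeasurePreserving θ (μ.restrict A) (μ.restrict B)) :
    ∃ U : Lp ℂ 2 μ →L[ℂ] Lp ℂ 2 μ, ∀ f, U f =ᵐ[μ] A.indicator (f ∘ θ) := by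
  have hcomp : ∀ {f g : X → ℂ}, f =ᵐ[μ] g → A.indicator (f ∘ θ) =ᵐ[μ] A.indicator (g ∘ θ) :=
    indicator_comp_ae_eq hA hθ
  refine ⟨LinearMap.mkContinuous
    { toFun := fun f => (memLp_indicator_comp hA hθ f).toLp
      map_add' := fun f g => ?_
      map_smul' := fun c f => ?_ } 1 fun f => ?_, fun f => ?_⟩
  · rw [← MemLp.toLp_add]
    refine MemLp.toLp_congr _ _ ((hcomp (Lp.coeFn_add f g)).trans (.of_eq ?_))
    rw [← Set.indicator_add']
    rfl
  · rw [RingHom.id_apply, ← MemLp.toLp_const_smul]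
    refine MemLp.toLp_congr _ _ ((hcomp (Lp.coeFn_smul c f)).trans (.of_eq ?_))
    exact Set.indicator_const_smul A c (f ∘ θ)
  · rw [one_mul]
    simp only [LinearMap.coe_mk, AddHom.coe_mk]
    rw [Lp.norm_toLp, Lp.norm_def]
    refine ENNReal.toReal_mono (Lp.eLpNorm_ne_top f) ?_
    rw [eLpNorm_indicator_eq_eLpNorm_restrict hA,
      eLpNorm_comp_measurePreserving ((Lp.aestronglyMeasurable f).restrict) hθ]
    exact eLpNorm_restrict_le _ _ _ _
  · exact MemLp.coeFn_toLp (memLp_indicator_comp hA hθ f)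

theorem inner_indicator_comp {A B : Set X} (hA : MeasurableSet A) (hB : MeasurableSet B)
    {θ τ : X → X} (hθ : MeasurePreserving θ (μ.restrict A) (μ.restrict B))
    (hτ : MeasurePreserving τ (μ.restrict B) (μ.restrict A)) (hτθ : ∀ x ∈ A, τ (θ x) = x)
    {U V : Lp ℂ 2 μ →L[ℂ] Lp ℂ 2 μ} (hU : ∀ f, U f =ᵐ[μ] A.indicator (f ∘ θ))
    (hV : ∀ f, V f =ᵐ[μ] B.indicator (f ∘ τ)) (f g : Lp ℂ 2 μ) :
    ⟪U f, g⟫_ℂ = ⟪f, V g⟫_ℂ := by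
  have h1 : ⟪U f, g⟫_ℂ = ∫ x in A, ⟪f (θ x), g x⟫_ℂ ∂μ := by
    rw [L2.inner_def, ← integral_indicator hA]
    refine integral_congr_ae ?_
    filter_upwards [hU f] with x hx
    rw [hx]
    by_cases h : x ∈ A <;> simp [h]
  have h2 : ⟪f, V g⟫_ℂ = ∫ y in B, ⟪f y, g (τ y)⟫_ℂ ∂μ := by
    rw [L2.inner_def, ← integral_indicator hB]
    refine integral_congr_ae ?_
    filter_upwards [hV g] with x hx
    rw [hx]
    by_cases h : x ∈ B <;> simp [h]
  have hmeas : AEStronglyMeasurable (fun y => ⟪f y, g (τ y)⟫_ℂ) (μ.restrict B) :=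
    (Lp.aestronglyMeasurable f).restrict.inner
      ((Lp.aestronglyMeasurable g).restrict.comp_measurePreserving hτ)
  rw [h1, h2]
  conv_rhs => rw [← hθ.map_eq]
  rw [integral_map hθ.aemeasurable (hθ.map_eq.symm ▸ hmeas)]
  refine setIntegral_congr_fun hA fun x hx => ?_
  simp only [hτθ x hx]

end Transfer

/-! ### Operators of Borel partial injections. -/

namespace BorelGraph

/-- By Lusin–Souslin the first projection embeds `D` measurably, so the second coordinate becomes a
Borel function on its image and extends to `X`. -/
theorem exists_measurable_of_injOn_fst {X : Type*} [MeasurableSpace X] [StandardBorelSpace X]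
    {D : Set (X × X)} (hD : MeasurableSet D) (h₁ : Set.InjOn Prod.fst D) :
    ∃ θ : X → X, Measurable θ ∧ ∀ p ∈ D, θ p.1 = p.2 := by
  have := hD.standardBorel
  have hemb : MeasurableEmbedding fun p : D => p.1.1 :=
    (measurable_fst.comp measurable_subtype_coe).measurableEmbedding fun p q h =>
      Subtype.ext (h₁ p.2 q.2 h)
  obtain ⟨θ, hθ, h⟩ := hemb.exists_measurable_extend
    (g := fun p : D => p.1.2) (measurable_snd.comp measurable_subtype_coe) fun x => ⟨x⟩
  exact ⟨θ, hθ, fun p hp => congrFun h ⟨p, hp⟩⟩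

theorem indicator_comp_eq_finsum {X : Type*} {D : Set (X × X)} (h₁ : Set.InjOn Prod.fst D) {θ : X → X}
    (h : ∀ p ∈ D, θ p.1 = p.2) (g : X → ℂ) (x : X) :
    (Prod.fst '' D).indicator (g ∘ θ) x = ∑ᶠ y ∈ {y | (x, y) ∈ D}, g y := by
  by_cases hx : x ∈ Prod.fst '' D
  · obtain ⟨p, hp, rfl⟩ := hx
    have : {y | (p.1, y) ∈ D} = {p.2} := by
      ext y
      exact ⟨fun hy => (Prod.ext_iff.1 (h₁ hy hp rfl)).2, fun hy => by
        rw [Set.mem_singleton_iff.1 hy]; exact hp⟩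
    rw [this, finsum_mem_singleton, Set.indicator_of_mem (Set.mem_image_of_mem _ hp),
      Function.comp_apply, h p hp]
  · have : {y | (x, y) ∈ D} = ∅ :=
      Set.eq_empty_of_forall_notMem fun y hy => hx ⟨_, hy, rfl⟩
    rw [this, finsum_mem_empty, Set.indicator_of_notMem hx]

variable {X : Type*} [MeasurableSpace X] [StandardBorelSpace X] {μ : Measure X}
  {G : SimpleGraph X}

theorem measurePreserving_of_graph (hpmp : IsMeasurePreserving G μ) {D : Set (X × X)}
    (hD : MeasurableSet D) (h₁ : Set.InjOn Prod.fst D) (h₂ : Set.InjOn Prod.snd D)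
    (hG : ∀ p ∈ D, G.Reachable p.1 p.2) {θ : X → X} (hθ : Measurable θ)
    (h : ∀ p ∈ D, θ p.1 = p.2) :
    MeasurePreserving θ (μ.restrict (Prod.fst '' D)) (μ.restrict (Prod.snd '' D)) := by
  refine ⟨hθ, Measure.ext fun C hC => ?_⟩
  have hA : MeasurableSet (Prod.fst '' D) := hD.image_of_measurable_injOn measurable_fst h₁
  -- The hypothesis is applied to the part of the domain that `θ` sends into `C`.
  rw [Measure.map_apply hθ hC, Measure.restrict_apply (hθ hC), Measure.restrict_apply hC,
    ← hpmp _ θ ((hθ hC).inter hA) hθ]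
  · congr 1
    ext y
    constructor
    · rintro ⟨_, ⟨hC, p, hp, rfl⟩, rfl⟩
      exact ⟨hC, p, hp, (h p hp).symm⟩
    · rintro ⟨hC, p, hp, rfl⟩
      exact ⟨p.1, ⟨by rwa [Set.mem_preimage, h p hp], p, hp, rfl⟩, h p hp⟩
  · rintro _ ⟨-, p, hp, rfl⟩ _ ⟨-, q, hq, rfl⟩ hpq
    rw [h p hp, h q hq] at hpq
    rw [h₂ hp hq hpq]
  · rintro _ ⟨-, p, hp, rfl⟩
    rw [h p hp]
    exact hG p hp

theorem exists_operator_of_graph (hpmp : IsMeasurePreserving G μ) {D : Set (X × X)}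
    (hD : MeasurableSet D) (h₁ : Set.InjOn Prod.fst D) (h₂ : Set.InjOn Prod.snd D)
    (hG : ∀ p ∈ D, G.Reachable p.1 p.2) :
    ∃ U V : Lp ℂ 2 μ →L[ℂ] Lp ℂ 2 μ,
      (∀ (f : Lp ℂ 2 μ) (g : X → ℂ), g =ᵐ[μ] f →
        U f =ᵐ[μ] fun x => ∑ᶠ y ∈ {y | (x, y) ∈ D}, g y) ∧
      (∀ (f : Lp ℂ 2 μ) (g : X → ℂ), g =ᵐ[μ] f →
        V f =ᵐ[μ] fun y => ∑ᶠ x ∈ {x | (x, y) ∈ D}, g x) ∧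
      ∀ f g, ⟪U f, g⟫_ℂ = ⟪f, V g⟫_ℂ := by
  have hD' : MeasurableSet (Prod.swap ⁻¹' D) := measurable_swap hD
  have h₁' : Set.InjOn Prod.fst (Prod.swap ⁻¹' D) := fun p hp q hq h =>
    Prod.swap_injective (h₂ hp hq h)
  have h₂' : Set.InjOn Prod.snd (Prod.swap ⁻¹' D) := fun p hp q hq h =>
    Prod.swap_injective (h₁ hp hq h)
  have hfst : Prod.fst '' (Prod.swap ⁻¹' D) = Prod.snd '' D := by ext; simp
  have hsnd : Prod.snd '' (Prod.swap ⁻¹' D) = Prod.fst '' D := by ext; simp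
  obtain ⟨θ, hθ, hθD⟩ := exists_measurable_of_injOn_fst hD h₁
  obtain ⟨τ, hτ, hτD⟩ := exists_measurable_of_injOn_fst hD' h₁'
  have hA := hD.image_of_measurable_injOn measurable_fst h₁
  have hB := hD.image_of_measurable_injOn measurable_snd h₂
  have mθ := measurePreserving_of_graph hpmp hD h₁ h₂ hG hθ hθD
  have mτ := measurePreserving_of_graph hpmp hD' h₁' h₂' (fun p hp => (hG _ hp).symm) hτ hτD
  rw [hfst, hsnd] at mτ
  obtain ⟨U, hU⟩ := exists_indicator_comp hA mθ
  obtain ⟨V, hV⟩ := exists_indicator_comp hB mτ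
  refine ⟨U, V, fun f g hfg => ?_, fun f g hfg => ?_,
    inner_indicator_comp hA hB mθ mτ ?_ hU hV⟩
  · refine (hU f).trans ?_
    refine (indicator_comp_ae_eq hA mθ hfg.symm).trans (.of_eq ?_)
    exact funext fun x => indicator_comp_eq_finsum h₁ hθD g x
  · refine (hV f).trans ?_
    refine (indicator_comp_ae_eq hB mτ hfg.symm).trans (.of_eq ?_)
    rw [← hfst]
    exact funext fun x => indicator_comp_eq_finsum h₁' hτD g x
  · rintro _ ⟨p, hp, rfl⟩
    rw [hθD p hp]
    exact hτD p.swap (by simpa using hp)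

end BorelGraph

/-! ### Construction of the adjacency operator. -/

namespace BorelGraph

variable {X : Type*} [MeasurableSpace X] {μ : Measure X} {G : SimpleGraph X}

theorem HasBoundedDegree.exists_measurableSet (hdeg : HasBoundedDegree G μ) :
    ∃ (d : ℕ) (W : Set X), MeasurableSet W ∧ (∀ᵐ x ∂μ, x ∈ W) ∧
      ∀ x ∈ W, ∀ y, G.Reachable x y → (G.neighborSet y).encard ≤ d := by
  obtain ⟨d, hd⟩ := hdeg
  refine ⟨d, (toMeasurable μ {x | ¬ ∀ y, G.Reachable x y → (G.neighborSet y).encard ≤ d})ᶜ,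
    (measurableSet_toMeasurable _ _).compl, ?_, fun x hx => ?_⟩
  · rw [ae_iff]
    simpa only [Set.mem_compl_iff, not_not, Set.ofPred_mem_eq, measure_toMeasurable]
      using ae_iff.1 hd
  · by_contra h
    exact hx (subset_toMeasurable _ _ h)

theorem measurableSet_edges (hBorel : IsBorel G) {W : Set X} (hW : MeasurableSet W) :
    MeasurableSet {p : X × X | G.Adj p.1 p.2 ∧ p.1 ∈ W} :=
  hBorel.inter (measurable_fst hW)

theorem encard_edges_le {X : Type*} {G : SimpleGraph X} {d : ℕ} {W : Set X}
    (hd : ∀ x ∈ W, ∀ y, G.Reachable x y → (G.neighborSet y).encard ≤ d) (x : X) :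
    {y | (x, y) ∈ {p : X × X | G.Adj p.1 p.2 ∧ p.1 ∈ W}}.encard ≤ d := by
  by_cases hx : x ∈ W
  · exact (Set.encard_le_encard fun y hy => hy.1).trans (hd x hx x (SimpleGraph.Reachable.refl x))
  · simp [hx]

/-- The endpoint `y` may lie outside `W`; its degree is bounded because it is in the component of a
point of `W`. -/
theorem encard_edges_swap_le {X : Type*} {G : SimpleGraph X} {d : ℕ} {W : Set X}
    (hd : ∀ x ∈ W, ∀ y, G.Reachable x y → (G.neighborSet y).encard ≤ d) (y : X) :
    {x | (x, y) ∈ {p : X × X | G.Adj p.1 p.2 ∧ p.1 ∈ W}}.encard ≤ d := by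
  rcases Set.eq_empty_or_nonempty {x | (x, y) ∈ {p : X × X | G.Adj p.1 p.2 ∧ p.1 ∈ W}} with
    h | ⟨x, hxy, hx⟩
  · rw [h]
    simp
  · exact (Set.encard_le_encard fun z hz => hz.1.symm).trans (hd x hx y hxy.reachable)

variable [StandardBorelSpace X]

/-- The countings of the edges from `W` into both directions define adjoint operators. -/
theorem exists_adjoint_operators (hBorel : IsBorel G) (hpmp : IsMeasurePreserving G μ) {d : ℕ}
    {W : Set X} (hW : MeasurableSet W)
    (hd : ∀ x ∈ W, ∀ y, G.Reachable x y → (G.neighborSet y).encard ≤ d) :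
    ∃ T S : Lp ℂ 2 μ →L[ℂ] Lp ℂ 2 μ,
      (∀ (f : Lp ℂ 2 μ) (g : X → ℂ), g =ᵐ[μ] f →
        T f =ᵐ[μ] fun x => ∑ᶠ y ∈ {y | G.Adj x y ∧ x ∈ W}, g y) ∧
      (∀ (f : Lp ℂ 2 μ) (g : X → ℂ), g =ᵐ[μ] f →
        S f =ᵐ[μ] fun y => ∑ᶠ x ∈ {x | G.Adj x y ∧ x ∈ W}, g x) ∧
      ∀ f g, ⟪T f, g⟫_ℂ = ⟪f, S g⟫_ℂ := by
  obtain ⟨D, hD, h₁, h₂, hdisj, hU⟩ := exists_partition_injections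
    (measurableSet_edges hBorel hW) (encard_edges_le hd) (encard_edges_swap_le hd)
  have hsub : ∀ i, ∀ p ∈ D i, G.Adj p.1 p.2 ∧ p.1 ∈ W := fun i p hp =>
    (hU ▸ Set.mem_iUnion_of_mem i hp : p ∈ {p : X × X | G.Adj p.1 p.2 ∧ p.1 ∈ W})
  have hmem : ∀ x y, G.Adj x y ∧ x ∈ W ↔ ∃ i, (x, y) ∈ D i := fun x y => by
    rw [← Set.mem_iUnion, hU]
    rfl
  choose U V hUf hVf hUV using fun i => exists_operator_of_graph hpmp (hD i) (h₁ i) (h₂ i)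
    fun p hp => (hsub i p hp).1.reachable
  refine ⟨∑ i, U i, ∑ i, V i, fun f g hfg => ?_, fun f g hfg => ?_, fun f g => ?_⟩
  · rw [sum_apply]
    filter_upwards [Lp.coeFn_finsetSum Finset.univ fun i => U i f,
      ae_all_iff.2 fun i => hUf i f g hfg] with x hx hx'
    have hsum : ∑ᶠ y ∈ {y | G.Adj x y ∧ x ∈ W}, g y =
        ∑ i, ∑ᶠ y ∈ {y | (x, y) ∈ D i}, g y := by
      have : {y | G.Adj x y ∧ x ∈ W} = ⋃ i, {y | (x, y) ∈ D i} := by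
        ext y
        rw [Set.mem_iUnion]
        exact hmem x y
      rw [this, finsum_mem_iUnion, finsum_eq_sum_of_fintype]
      · exact fun i j hij => Set.disjoint_left.2 fun y hy => Set.disjoint_left.1 (hdisj hij) hy
      · exact fun i => (Set.finite_of_encard_le_coe (encard_edges_le hd x)).subset
          fun y hy => hsub i _ hy
    rw [hx, Finset.sum_apply]
    exact (Finset.sum_congr rfl fun i _ => hx' i).trans hsum.symm
  · rw [sum_apply]
    filter_upwards [Lp.coeFn_finsetSum Finset.univ fun i => V i f,
      ae_all_iff.2 fun i => hVf i f g hfg] with y hy hy'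
    have hsum : ∑ᶠ x ∈ {x | G.Adj x y ∧ x ∈ W}, g x =
        ∑ i, ∑ᶠ x ∈ {x | (x, y) ∈ D i}, g x := by
      have : {x | G.Adj x y ∧ x ∈ W} = ⋃ i, {x | (x, y) ∈ D i} := by
        ext x
        rw [Set.mem_iUnion]
        exact hmem x y
      rw [this, finsum_mem_iUnion, finsum_eq_sum_of_fintype]
      · exact fun i j hij => Set.disjoint_left.2 fun x hy => Set.disjoint_left.1 (hdisj hij) hy
      · exact fun i => (Set.finite_of_encard_le_coe (encard_edges_swap_le hd y)).subset
          fun x hx => hsub i _ hx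
    rw [hy, Finset.sum_apply]
    exact (Finset.sum_congr rfl fun i _ => hy' i).trans hsum.symm
  · simp only [sum_apply, sum_inner, inner_sum, hUV]

/-- The adjacency operator of a measure preserving graph of bounded degree exists, and it is
self-adjoint. -/
theorem exists_isAdjacencyOperator (hBorel : IsBorel G) (hdeg : HasBoundedDegree G μ)
    (hpmp : IsMeasurePreserving G μ) :
    ∃ T : Lp ℂ 2 μ →L[ℂ] Lp ℂ 2 μ, IsAdjacencyOperator G μ T ∧ IsSelfAdjoint T := by
  obtain ⟨d, W, hW, hWae, hd⟩ := hdeg.exists_measurableSet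
  obtain ⟨T, S, hT, hS, hTS⟩ := exists_adjoint_operators hBorel hpmp hW hd
  have hTadj : IsAdjacencyOperator G μ T := fun f g hfg => by
    filter_upwards [hT f g hfg, hWae] with x hx hxW
    rw [hx]
    congr! 4 with y
    simp [hxW]
  -- `W` need not be invariant. But the indicator of its complement is zero in `L²`, so `T` kills
  -- it, and its neighbour sum counts the neighbours outside `W`.
  have hnbr : ∀ᵐ x ∂μ, ∀ y, G.Adj x y → y ∈ W := by
    have hzero : Wᶜ.indicator (fun _ => (1 : ℂ)) =ᵐ[μ] (0 : Lp ℂ 2 μ) := by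
      filter_upwards [hWae, Lp.coeFn_zero ℂ 2 μ] with x hx h0
      exact (Set.indicator_of_notMem (by simpa using hx) _).trans h0.symm
    have h := hTadj 0 _ hzero
    rw [map_zero] at h
    filter_upwards [h, Lp.coeFn_zero ℂ 2 μ, hWae] with x hx h0 hxW y hy
    have hfin : (G.neighborSet x).Finite :=
      Set.finite_of_encard_le_coe (hd x hxW x (SimpleGraph.Reachable.refl x))
    rw [h0, finsum_mem_eq_finite_toFinset_sum _ hfin] at hx
    classical
    simp only [Set.indicator_apply, Finset.sum_boole, Pi.zero_apply] at hx
    by_contra hyW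
    have hmem : y ∈ hfin.toFinset.filter (· ∈ Wᶜ) := by
      simpa [hyW] using hy
    exact (Finset.card_pos.2 ⟨y, hmem⟩).ne (by exact_mod_cast hx)
  have hST : S = T := by
    ext1 f
    refine Lp.ext ?_
    filter_upwards [hS f f .rfl, hTadj f f .rfl, hnbr] with y h1 h2 hy
    rw [h1, h2]
    congr! 4 with x
    rw [SimpleGraph.mem_neighborSet, G.adj_comm x y]
    exact and_iff_left_of_imp (hy x)
  refine ⟨T, hTadj, ?_⟩
  rw [ContinuousLinearMap.isSelfAdjoint_iff_isSymmetric]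
  intro f g
  exact (hTS f g).trans (by rw [hST]; rfl)

end BorelGraph

/-! ### From approximate colourings to quadratic form bounds. -/

namespace BorelGraph

section Approximation

variable {X : Type*} [MeasurableSpace X] {μ : Measure X} {G : SimpleGraph X}

theorem exists_forall_norm_indicator_sub_le [IsProbabilityMeasure μ] (f : Lp ℂ 2 μ) {δ : ℝ}
    (hδ : 0 < δ) :
    ∃ ε : ℝ, 0 < ε ∧ ∀ C : Set X, ∀ hC : MeasurableSet C, 1 - ε < μ.real C →
      ‖f - ((Lp.memLp f).indicator hC).toLp‖ ≤ δ := by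
  obtain ⟨ε, hε, h⟩ := (Lp.memLp f).eLpNorm_indicator_le (by norm_num) (by norm_num) hδ
  refine ⟨ε, hε, fun C hC hμC => ?_⟩
  have hcompl : μ Cᶜ ≤ ENNReal.ofReal ε := by
    rw [← ofReal_measureReal, probReal_compl_eq_one_sub hC]
    exact ENNReal.ofReal_le_ofReal (by linarith)
  rw [Lp.norm_def]
  refine ENNReal.toReal_le_of_le_ofReal hδ.le ((eLpNorm_congr_ae ?_).trans_le (h _ hC.compl hcompl))
  filter_upwards [Lp.coeFn_sub f ((Lp.memLp f).indicator hC).toLp,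
    ((Lp.memLp f).indicator hC).coeFn_toLp] with x h1 h2
  rw [h1, Pi.sub_apply, h2]
  by_cases hx : x ∈ C <;> simp [hx]

/-- A quadratic upper bound for `T` extends to all of `L²` if it holds for the functions supported
on sets of measure arbitrarily close to `1`. -/
theorem reApplyInnerSelf_le_of_approx [IsProbabilityMeasure μ] {T : Lp ℂ 2 μ →L[ℂ] Lp ℂ 2 μ}
    {c : ℝ} (h : ∀ ε : ℝ, 0 < ε → ∃ C : Set X, MeasurableSet C ∧ 1 - ε < μ.real C ∧
      ∀ g : Lp ℂ 2 μ, g =ᵐ[μ] C.indicator g → T.reApplyInnerSelf g ≤ c * ‖g‖ ^ 2)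
    (f : Lp ℂ 2 μ) : T.reApplyInnerSelf f ≤ c * ‖f‖ ^ 2 := by
  have hclosed : IsClosed {g : Lp ℂ 2 μ | T.reApplyInnerSelf g ≤ c * ‖g‖ ^ 2} :=
    isClosed_le T.reApplyInnerSelf_continuous (by fun_prop)
  refine hclosed.closure_subset (Metric.mem_closure_iff.2 fun δ hδ => ?_)
  obtain ⟨ε, hε, hf⟩ := exists_forall_norm_indicator_sub_le f (half_pos hδ)
  obtain ⟨C, hC, hμC, hT⟩ := h ε hε
  refine ⟨((Lp.memLp f).indicator hC).toLp, hT _ ?_, ?_⟩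
  · filter_upwards [((Lp.memLp f).indicator hC).coeFn_toLp] with x hx
    by_cases hxC : x ∈ C
    · rw [Set.indicator_of_mem hxC]
    · rw [hx, Set.indicator_of_notMem hxC, Set.indicator_of_notMem hxC]
  · rw [dist_eq_norm]
    exact (hf C hC hμC).trans_lt (half_lt_self hδ)

/-- Evaluated on the representative that vanishes off `s`, the neighbour sum is zero at points of
`s`, while `f` is zero elsewhere. -/
theorem reApplyInnerSelf_eq_zero_of_independent {T : Lp ℂ 2 μ →L[ℂ] Lp ℂ 2 μ}
    (hT : IsAdjacencyOperator G μ T) {s : Set X} (hs : ∀ x ∈ s, ∀ y ∈ s, ¬ G.Adj x y)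
    {f : Lp ℂ 2 μ} (hf : f =ᵐ[μ] s.indicator f) : T.reApplyInnerSelf f = 0 := by
  rw [ContinuousLinearMap.reApplyInnerSelf_apply, L2.inner_def]
  have h0 : (fun x => ⟪T f x, f x⟫_ℂ) =ᵐ[μ] fun _ => 0 := by
    filter_upwards [hT f _ hf.symm, hf] with x hx hfx
    by_cases hxs : x ∈ s
    · have : ∑ᶠ y ∈ G.neighborSet x, s.indicator f y = 0 :=
        finsum_mem_eq_zero_of_forall_eq_zero fun y hy =>
          Set.indicator_of_notMem (fun hys => hs x hxs y hys hy) _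
      rw [hx, this, inner_zero_left]
    · rw [hfx, Set.indicator_of_notMem hxs, inner_zero_right]
  rw [integral_congr_ae h0]
  simp

theorem reApplyInnerSelf_le_of_independent_cover {ι : Type*} [Fintype ι]
    {T : Lp ℂ 2 μ →L[ℂ] Lp ℂ 2 μ} (hT : IsAdjacencyOperator G μ T) {m : ℝ}
    (hm : ∀ f, m * ‖f‖ ^ 2 ≤ T.reApplyInnerSelf f) {s : ι → Set X}
    (hs : ∀ i, MeasurableSet (s i)) (hdisj : Pairwise (Function.onFun Disjoint s))
    (hind : ∀ i, ∀ x ∈ s i, ∀ y ∈ s i, ¬ G.Adj x y) {f : Lp ℂ 2 μ}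
    (hf : f =ᵐ[μ] (⋃ i, s i).indicator f) :
    T.reApplyInnerSelf f ≤ -((Fintype.card ι : ℝ) - 1) * m * ‖f‖ ^ 2 := by
  have hae : ∀ i, ((Lp.memLp f).indicator (hs i)).toLp =ᵐ[μ] (s i).indicator f :=
    fun i => ((Lp.memLp f).indicator (hs i)).coeFn_toLp
  have hsum : f = ∑ i, ((Lp.memLp f).indicator (hs i)).toLp := by
    refine Lp.ext ?_
    filter_upwards [hf, ae_all_iff.2 hae, Lp.coeFn_finsetSum Finset.univ
      fun i => ((Lp.memLp f).indicator (hs i)).toLp] with x hx hi hS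
    rw [hS, Finset.sum_apply, Finset.sum_congr rfl fun i _ => hi i, hx]
    by_cases hxU : x ∈ ⋃ i, s i
    · obtain ⟨i, hxi⟩ := Set.mem_iUnion.1 hxU
      rw [Set.indicator_of_mem hxU, Finset.sum_eq_single i, Set.indicator_of_mem hxi]
      · exact fun j _ hj => Set.indicator_of_notMem
          (fun hxj => Set.disjoint_left.1 (hdisj hj) hxj hxi) _
      · simp
    · rw [Set.indicator_of_notMem hxU, Finset.sum_eq_zero]
      exact fun i _ => Set.indicator_of_notMem (fun hxi => hxU (Set.mem_iUnion_of_mem i hxi)) _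
  rw [hsum]
  refine reApplyInnerSelf_sum_le hm (fun i j hij => ?_) fun i =>
    reApplyInnerSelf_eq_zero_of_independent hT (hind i) ?_
  · beta_reduce
    rw [L2.inner_def]
    refine integral_eq_zero_of_ae ?_
    filter_upwards [hae i, hae j] with x hi hj
    rw [hi, hj]
    by_cases hxi : x ∈ s i
    · rw [Set.indicator_of_notMem (Set.disjoint_left.1 (hdisj hij) hxi), inner_zero_right]
      rfl
    · rw [Set.indicator_of_notMem hxi, inner_zero_left]
      rfl
  · filter_upwards [hae i] with x hx
    by_cases hxi : x ∈ s i
    · rw [Set.indicator_of_mem hxi]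
    · rw [hx, Set.indicator_of_notMem hxi, Set.indicator_of_notMem hxi]

/-- Hoffman's inequality for approximately `k`-colourable graphs. -/
theorem ApproxColorable.reApplyInnerSelf_le [IsProbabilityMeasure μ] {k : ℕ}
    (hk : ApproxColorable G μ k) {T : Lp ℂ 2 μ →L[ℂ] Lp ℂ 2 μ} (hT : IsAdjacencyOperator G μ T)
    {m : ℝ} (hm : ∀ f, m * ‖f‖ ^ 2 ≤ T.reApplyInnerSelf f) (f : Lp ℂ 2 μ) :
    T.reApplyInnerSelf f ≤ -((k : ℝ) - 1) * m * ‖f‖ ^ 2 := by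
  refine reApplyInnerSelf_le_of_approx (fun ε hε => ?_) f
  obtain ⟨A, hA, hμA, c, hc⟩ := hk ε hε
  -- Colour classes are only null-measurable; Borel subsets of full measure in them stay disjoint
  -- and independent.
  choose t hts ht hteq using fun i => (hc i).exists_measurable_subset_ae_eq
  have hUnion : ⋃ i, Subtype.val '' {a : A | c a = i} = A := by
    ext x
    simp
  have hU : (⋃ i, t i : Set X) =ᵐ[μ] A := by
    have := Filter.EventuallyEq.countable_iUnion hteq
    rwa [hUnion] at this
  refine ⟨⋃ i, t i, MeasurableSet.iUnion ht, by rwa [measureReal_congr hU], fun g hg => ?_⟩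
  have := reApplyInnerSelf_le_of_independent_cover hT hm ht (fun i j hij => ?_) (fun i => ?_) hg
  · simpa using this
  · refine Set.disjoint_left.2 fun x hi hj => hij ?_
    obtain ⟨a, ha, rfl⟩ := hts i hi
    obtain ⟨b, hb, hab⟩ := hts j hj
    rw [← ha, ← hb, Subtype.ext hab]
  · intro x hx y hy hxy
    obtain ⟨a, ha, rfl⟩ := hts i hx
    obtain ⟨b, hb, rfl⟩ := hts i hy
    exact c.valid (v := a) (w := b) hxy (ha.trans hb.symm)

theorem ApproxColorable.one_le {k : ℕ} (hk : ApproxColorable G μ k) : 1 ≤ k := by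
  obtain ⟨A, -, hμA, c, -⟩ := hk 1 one_pos
  obtain ⟨a, ha⟩ : A.Nonempty := by
    refine Set.nonempty_iff_ne_empty.2 fun h => ?_
    simp [h] at hμA
  exact (c ⟨a, ha⟩).pos

end Approximation

/-! ### Countable Borel independent covers and the sign of the lower bound. -/

variable {X : Type*} [MeasurableSpace X] [StandardBorelSpace X] {μ : Measure X}
  {G : SimpleGraph X}

/-- The points of a basic open set with no neighbour in it are independent. Every point of `W` has
finitely many neighbours, hence a basic neighbourhood avoiding them. -/
theorem exists_independent_cover (hBorel : IsBorel G) {d : ℕ} {W : Set X} (hW : MeasurableSet W)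
    (hd : ∀ x ∈ W, ∀ y, G.Reachable x y → (G.neighborSet y).encard ≤ d) :
    ∃ B : ℕ → Set X, (∀ n, MeasurableSet (B n)) ∧ (∀ n, ∀ x ∈ B n, ∀ y ∈ B n, ¬ G.Adj x y) ∧
      W ⊆ ⋃ n, B n := by
  let _ := upgradeStandardBorel X
  obtain ⟨b, hbc, -, hb⟩ := TopologicalSpace.exists_countable_basis X
  -- Adding `∅` makes the family nonempty, as enumeration by `ℕ` requires.
  obtain ⟨U, hU⟩ := (hbc.insert ∅).exists_eq_range (Set.insert_nonempty _ _)
  have hUm : ∀ n, MeasurableSet (U n) := fun n => by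
    rcases (hU ▸ Set.mem_range_self n : U n ∈ insert ∅ b) with h | h
    · rw [h]
      exact MeasurableSet.empty
    · exact (hb.isOpen h).measurableSet
  refine ⟨fun n => (W ∩ U n) \ (Prod.fst '' ({p : X × X | G.Adj p.1 p.2 ∧ p.1 ∈ W} ∩
    Prod.snd ⁻¹' U n)), fun n => ?_, ?_, ?_⟩
  · refine (hW.inter (hUm n)).diff (measurableSet_image_fst_of_encard_le d
      ((measurableSet_edges hBorel hW).inter (measurable_snd (hUm n))) fun x => ?_)
    exact (Set.encard_le_encard fun y hy => hy.1).trans (encard_edges_le hd x)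
  · rintro n x ⟨⟨hxW, -⟩, hx⟩ y ⟨⟨-, hy⟩, -⟩ hxy
    exact hx ⟨(x, y), ⟨⟨hxy, hxW⟩, hy⟩, rfl⟩
  · intro x hx
    have hfin : (G.neighborSet x).Finite :=
      Set.finite_of_encard_le_coe (hd x hx x (SimpleGraph.Reachable.refl x))
    obtain ⟨V, hV, hxV, hVsub⟩ := hb.exists_subset_of_mem_open
      (show x ∈ (G.neighborSet x)ᶜ by simp) hfin.isClosed.isOpen_compl
    obtain ⟨n, rfl⟩ := (hU ▸ Set.mem_insert_of_mem ∅ hV : V ∈ Set.range U)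
    refine Set.mem_iUnion.2 ⟨n, ⟨hx, hxV⟩, ?_⟩
    rintro ⟨⟨z, y⟩, ⟨⟨hzy, -⟩, hy⟩, rfl⟩
    exact hVsub hy hzy

/-- A positive adjacency operator vanishes. -/
theorem IsAdjacencyOperator.eq_zero_of_nonneg [IsProbabilityMeasure μ] (hBorel : IsBorel G)
    (hdeg : HasBoundedDegree G μ) {T : Lp ℂ 2 μ →L[ℂ] Lp ℂ 2 μ} (hT : IsAdjacencyOperator G μ T)
    (hsa : IsSelfAdjoint T) (hpos : ∀ f, 0 ≤ T.reApplyInnerSelf f) : T = 0 := by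
  obtain ⟨d, W, hW, hWae, hd⟩ := hdeg.exists_measurableSet
  obtain ⟨B, hB, hind, hcov⟩ := exists_independent_cover hBorel hW hd
  have hμ : μ (⋃ n, disjointed B n) = 1 := by
    rw [iUnion_disjointed, prob_compl_eq_zero_iff (MeasurableSet.iUnion hB) |>.1]
    exact measure_mono_null (Set.compl_subset_compl.2 hcov) hWae
  have hlim := tendsto_measure_iUnion_accumulate (μ := μ) (f := disjointed B)
  rw [hμ] at hlim
  refine eq_zero_of_reApplyInnerSelf_eq_zero hsa fun f => le_antisymm ?_ (hpos f)
  rw [← zero_mul (‖f‖ ^ 2)]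
  refine reApplyInnerSelf_le_of_approx (fun ε hε => ?_) f
  have hlim' := (ENNReal.tendsto_toReal ENNReal.one_ne_top).comp hlim
  obtain ⟨N, hN⟩ := (hlim'.eventually (lt_mem_nhds
    (show 1 - ε < (1 : ℝ≥0∞).toReal by simpa using hε))).exists
  have hU : Set.accumulate (disjointed B) N = ⋃ i : Fin (N + 1), disjointed B i := by
    ext x
    simp only [Set.mem_accumulate, Set.mem_iUnion]
    exact ⟨fun ⟨n, hn, hx⟩ => ⟨⟨n, Nat.lt_succ_of_le hn⟩, hx⟩,
      fun ⟨i, hx⟩ => ⟨i, Nat.le_of_lt_succ i.2, hx⟩⟩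
  have hDm : ∀ n, MeasurableSet (disjointed B n) := fun n => .disjointed hB n
  refine ⟨⋃ i : Fin (N + 1), disjointed B i, MeasurableSet.iUnion fun i => hDm i,
    by rw [← hU]; exact hN, fun g hg => ?_⟩
  have := reApplyInnerSelf_le_of_independent_cover hT (m := 0) (by simpa using hpos)
    (fun i : Fin (N + 1) => hDm i)
    (fun i j hij => disjoint_disjointed B (fun h => hij (Fin.ext h)))
    (fun i x hx y hy => hind i x (disjointed_subset B i hx) y (disjointed_subset B i hy)) hg
  simpa using this

end BorelGraph

/-- Hoffman's lower bound for the approximate measurable chromatic number. The adjacency operator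
`T` exists and is self-adjoint, `M(T)` and `m(T)` are its maximum and minimum spectral values,
`m(T) < 0` unless `T = 0`, and the bound holds (in the degenerate case `T = 0`, where
`M(T) = m(T) = 0`, the quotient reads as `0`). -/
theorem theorem6p6 {X : Type*} [MeasurableSpace X] [StandardBorelSpace X]
    (μ : Measure X) [IsProbabilityMeasure μ] (G : SimpleGraph X)
    (hBorel : BorelGraph.IsBorel G)
    (hdeg : BorelGraph.HasBoundedDegree G μ)
    (hpmp : BorelGraph.IsMeasurePreserving G μ) :
    ∃ T : Lp ℂ 2 μ →L[ℂ] Lp ℂ 2 μ,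
      BorelGraph.IsAdjacencyOperator G μ T ∧
      IsSelfAdjoint T ∧
      IsGreatest (realSpectralValues T) (upperSpectralBound T) ∧
      IsLeast (realSpectralValues T) (lowerSpectralBound T) ∧
      (T ≠ 0 → lowerSpectralBound T < 0) ∧
      ((⌈1 - upperSpectralBound T / lowerSpectralBound T⌉₊ : ℕ) : ℕ∞) ≤
        BorelGraph.approxChromaticNumber G μ := by
  have : Nontrivial (Lp ℂ 2 μ) := by
    refine ⟨⟨indicatorConstLp 2 MeasurableSet.univ (measure_ne_top μ _) 1, 0, fun h => ?_⟩⟩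
    have := norm_indicatorConstLp (μ := μ) (p := 2) (hs := MeasurableSet.univ)
      (hμs := measure_ne_top μ _) (c := (1 : ℂ)) (by norm_num) (by norm_num)
    rw [h] at this
    simp at this
  obtain ⟨T, hT, hsa⟩ := BorelGraph.exists_isAdjacencyOperator hBorel hdeg hpmp
  have hneg : T ≠ 0 → lowerSpectralBound T < 0 := fun hT0 => by
    by_contra! h
    refine hT0 (hT.eq_zero_of_nonneg hBorel hdeg hsa fun f => ?_)
    simpa using (le_lowerSpectralBound_iff T 0).1 h f
  refine ⟨T, hT, hsa, isGreatest_upperSpectralBound hsa, isLeast_lowerSpectralBound hsa, hneg,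
    le_iInf₂ fun k hk => ?_⟩
  rw [Nat.cast_le, Nat.ceil_le]
  by_cases hT0 : T = 0
  · have hM : upperSpectralBound T = 0 := by
      simp [upperSpectralBound, hT0]
    rw [hM, zero_div, sub_zero]
    -- For `T = 0` the claim is `1 ≤ k`: a set of positive measure needs a colour.
    exact_mod_cast hk.one_le
  · have h := (upperSpectralBound_le_iff T _).2
      (hk.reApplyInnerSelf_le hT ((le_lowerSpectralBound_iff T _).1 le_rfl))
    have := (le_div_iff_of_neg (hneg hT0)).2 h
    linarith
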